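/- Let $\mathfrak g$ be a finite-dimensional simple Lie algebra over $\mathbb C$ with Killing form $(\cdot,\cdot)$. The affine-Virasoro Lie algebra of $\mathfrak g$ is the complex vector space $$\mathfrak L(\mathfrak g)=\mathfrak g\otimes\mathbb C[t^{\pm1}]\ \oplus\ \mathbb C K_1\ \oplus\ \mathbb C K_2\ \oplus\ \bigoplus_{m\in\mathbb Z}\mathbb C d_m$$ with the Lie bracket determined by $$[x\otimes t^m,y\otimes t^n]=[x,y]\otimes t^{m+n}+m(x,y)\delta_{m+n,0}K_1,\qquad [\mathfrak L(\mathfrak g),K_1]=[\mathfrak L(\mathfrak g),K_2]=0,$$ $$[d_m,x\otimes t^n]=n\,x\otimes t^{m+n},\qquad [d_m,d_n]=(n-m)d_{m+n}+\delta_{m+n,0}\frac{m^3-m}{12}K_2$$ for all $x,y\in\mathfrak g$ and $m,n\in\mathbb Z$. A symmetric biderivation of a complex Lie algebra $L$ is a $\mathbb C$-bilinear map $F:L\times L\to L$ such that, for all $x,y,z\in L$, $$F([x,y],z)=[x,F(y,z)]-[y,F(x,z)],\qquad F(x,[y,z])=[y,F(x,z)]-[z,F(x,y)],\qquad F(x,y)=F(y,x).$$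 **Theorem.** Every symmetric biderivation $F$ of $\mathfrak L(\mathfrak g)$ is trivial, that is, $F(x,y)=0$ for all $x,y\in\mathfrak L(\mathfrak g)$. -/

import Mathlib

noncomputable section

namespace AffineVirasoro

/-! ### Structure maps

The loop algebra `𝔤 ⊗ ℂ[t, t⁻¹] = ⨁ n, 𝔤 ⊗ t ^ n` is realized as `ℤ →₀ 𝔤`, with `x ⊗ t ^ n` the
function `Finsupp.single n x`; `toFinsupp_lie` below identifies it with Mathlib's
`LieAlgebra.loopAlgebra ℂ ℤ 𝔤`. The space `⨁ m, ℂ d_m` is `ℤ →₀ ℂ`, with `d_m` the function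
`Finsupp.single m 1`. -/

section Bilinear

variable {M N P : Type*} [AddCommGroup M] [Module ℂ M] [AddCommGroup N] [Module ℂ N]
  [AddCommGroup P] [Module ℂ P]

/-- The bilinear map on finitely supported functions with components `B m n`. -/
def bilin (B : ℤ → ℤ → M →ₗ[ℂ] N →ₗ[ℂ] P) : (ℤ →₀ M) →ₗ[ℂ] (ℤ →₀ N) →ₗ[ℂ] P :=
  Finsupp.lsum ℂ fun m => (Finsupp.lsum ℂ fun n => (B m n).flip).flip

lemma bilin_single (B : ℤ → ℤ → M →ₗ[ℂ] N →ₗ[ℂ] P) (m n : ℤ) (x : M) (y : N) :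
    bilin B (Finsupp.single m x) (Finsupp.single n y) = B m n x y := by
  simp [bilin]

end Bilinear

/-- The bracket `[d_m, d_n] = (n - m) d_{m + n}` on `⨁ m, ℂ d_m`. -/
def wittBracket : (ℤ →₀ ℂ) →ₗ[ℂ] (ℤ →₀ ℂ) →ₗ[ℂ] (ℤ →₀ ℂ) :=
  bilin fun m n => ((n : ℂ) - (m : ℂ)) • (LinearMap.mul ℂ ℂ).compr₂ (Finsupp.lsingle (m + n))

/-- The Virasoro cocycle `(d_m, d_n) ↦ δ_{m + n, 0} (m ^ 3 - m) / 12`. -/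
def virasoroCocycle : (ℤ →₀ ℂ) →ₗ[ℂ] (ℤ →₀ ℂ) →ₗ[ℂ] ℂ :=
  bilin fun m n => (if m + n = 0 then ((m : ℂ) ^ 3 - (m : ℂ)) / 12 else 0) • LinearMap.mul ℂ ℂ

lemma wittBracket_single (m n : ℤ) (a b : ℂ) :
    wittBracket (Finsupp.single m a) (Finsupp.single n b) =
      Finsupp.single (m + n) (((n : ℂ) - m) * (a * b)) := by
  rw [wittBracket, bilin_single]
  simp only [LinearMap.smul_apply, LinearMap.compr₂_apply, LinearMap.mul_apply',
    Finsupp.lsingle_apply, Finsupp.smul_single, smul_eq_mul]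

lemma virasoroCocycle_single (m n : ℤ) (a b : ℂ) :
    virasoroCocycle (Finsupp.single m a) (Finsupp.single n b) =
      (if m + n = 0 then ((m : ℂ) ^ 3 - (m : ℂ)) / 12 else 0) * (a * b) := by
  rw [virasoroCocycle, bilin_single]
  simp only [LinearMap.smul_apply, LinearMap.mul_apply', smul_eq_mul]

lemma wittBracket_skew (u v : ℤ →₀ ℂ) : wittBracket u v = -wittBracket v u := by
  induction u using Finsupp.induction_linear with
  | zero => simp
  | add u u' hu hu' => simp only [map_add, LinearMap.add_apply, hu, hu']; abel
  | single m a =>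
  induction v using Finsupp.induction_linear with
  | zero => simp
  | add v v' hv hv' => simp only [map_add, LinearMap.add_apply, hv, hv']; abel
  | single n b =>
  rw [wittBracket_single, wittBracket_single, ← Finsupp.single_neg, add_comm n m]
  congr 1
  ring

lemma virasoroCocycle_skew (u v : ℤ →₀ ℂ) : virasoroCocycle u v = -virasoroCocycle v u := by
  induction u using Finsupp.induction_linear with
  | zero => simp
  | add u u' hu hu' => simp only [map_add, LinearMap.add_apply, hu, hu']; abel
  | single m a =>
  induction v using Finsupp.induction_linear with
  | zero => simp
  | add v v' hv hv' => simp only [map_add, LinearMap.add_apply, hv, hv']; abel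
  | single n b =>
  rw [virasoroCocycle_single, virasoroCocycle_single, add_comm n m]
  split_ifs with h
  · obtain rfl : n = -m := by omega
    push_cast
    ring
  · simp

lemma wittBracket_self (u : ℤ →₀ ℂ) : wittBracket u u = 0 :=
  self_eq_neg.mp (wittBracket_skew u u)

lemma virasoroCocycle_self (u : ℤ →₀ ℂ) : virasoroCocycle u u = 0 :=
  self_eq_neg.mp (virasoroCocycle_skew u u)

lemma wittBracket_jacobi (u v w : ℤ →₀ ℂ) :
    wittBracket u (wittBracket v w) =
      wittBracket (wittBracket u v) w + wittBracket v (wittBracket u w) := by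
  induction u using Finsupp.induction_linear with
  | zero => simp
  | add u u' hu hu' => simp only [map_add, LinearMap.add_apply, hu, hu']; abel
  | single m a =>
  induction v using Finsupp.induction_linear with
  | zero => simp
  | add v v' hv hv' => simp only [map_add, LinearMap.add_apply, hv, hv']; abel
  | single n b =>
  induction w using Finsupp.induction_linear with
  | zero => simp
  | add w w' hw hw' => simp only [map_add, hw, hw']; abel
  | single k c =>
  simp only [wittBracket_single]
  rw [show m + n + k = m + (n + k) by ring, show n + (m + k) = m + (n + k) by ring,
    ← Finsupp.single_add]
  congr 1
  push_cast
  ring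

lemma virasoroCocycle_jacobi (u v w : ℤ →₀ ℂ) :
    virasoroCocycle u (wittBracket v w) =
      virasoroCocycle (wittBracket u v) w + virasoroCocycle v (wittBracket u w) := by
  induction u using Finsupp.induction_linear with
  | zero => simp
  | add u u' hu hu' => simp only [map_add, LinearMap.add_apply, hu, hu']; ring
  | single m a =>
  induction v using Finsupp.induction_linear with
  | zero => simp
  | add v v' hv hv' => simp only [map_add, LinearMap.add_apply, hv, hv']; ring
  | single n b =>
  induction w using Finsupp.induction_linear with
  | zero => simp
  | add w w' hw hw' => simp only [map_add, hw, hw']; ring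
  | single k c =>
  simp only [wittBracket_single, virasoroCocycle_single]
  rw [show m + n + k = m + (n + k) by ring, show n + (m + k) = m + (n + k) by ring]
  split_ifs with h
  · obtain rfl : k = -(m + n) := by omega
    push_cast
    ring
  · simp

variable (𝔤 : Type*) [LieRing 𝔤] [LieAlgebra ℂ 𝔤]

/-- The loop bracket `[x ⊗ t ^ m, y ⊗ t ^ n] = [x, y] ⊗ t ^ (m + n)`. -/
def loopBracket : (ℤ →₀ 𝔤) →ₗ[ℂ] (ℤ →₀ 𝔤) →ₗ[ℂ] (ℤ →₀ 𝔤) :=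
  bilin fun m n => (LieModule.toEnd ℂ 𝔤 𝔤 : 𝔤 →ₗ[ℂ] 𝔤 →ₗ[ℂ] 𝔤).compr₂ (Finsupp.lsingle (m + n))

/-- The affine cocycle `(x ⊗ t ^ m, y ⊗ t ^ n) ↦ m (x, y) δ_{m + n, 0}`, where `(·, ·)` is the
Killing form. -/
def affineCocycle : (ℤ →₀ 𝔤) →ₗ[ℂ] (ℤ →₀ 𝔤) →ₗ[ℂ] ℂ :=
  bilin fun m n => (if m + n = 0 then (m : ℂ) else 0) • killingForm ℂ 𝔤

/-- The action of `⨁ m, ℂ d_m` on the loop algebra: `d_m` sends `x ⊗ t ^ n` to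
`n x ⊗ t ^ (m + n)`. -/
def loopAction : (ℤ →₀ ℂ) →ₗ[ℂ] (ℤ →₀ 𝔤) →ₗ[ℂ] (ℤ →₀ 𝔤) :=
  bilin fun m n =>
    (n : ℂ) • (LinearMap.lsmul ℂ 𝔤 : ℂ →ₗ[ℂ] 𝔤 →ₗ[ℂ] 𝔤).compr₂ (Finsupp.lsingle (m + n))

variable {𝔤}

lemma loopBracket_single (m n : ℤ) (x y : 𝔤) :
    loopBracket 𝔤 (Finsupp.single m x) (Finsupp.single n y) = Finsupp.single (m + n) ⁅x, y⁆ := by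
  rw [loopBracket, bilin_single]
  simp

lemma affineCocycle_single (m n : ℤ) (x y : 𝔤) :
    affineCocycle 𝔤 (Finsupp.single m x) (Finsupp.single n y) =
      (if m + n = 0 then (m : ℂ) else 0) * killingForm ℂ 𝔤 x y := by
  rw [affineCocycle, bilin_single]
  simp only [LinearMap.smul_apply, smul_eq_mul]

lemma loopAction_single (m n : ℤ) (a : ℂ) (x : 𝔤) :
    loopAction 𝔤 (Finsupp.single m a) (Finsupp.single n x) =
      Finsupp.single (m + n) (((n : ℂ) * a) • x) := by
  rw [loopAction, bilin_single]
  simp [mul_smul]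

/-- The loop bracket is the bracket of Mathlib's loop algebra `ℂ[t, t⁻¹] ⊗ 𝔤`. -/
lemma toFinsupp_lie (f g : LieAlgebra.loopAlgebra ℂ ℤ 𝔤) :
    LieAlgebra.LoopAlgebra.toFinsupp ℂ ℤ 𝔤 ⁅f, g⁆ =
      loopBracket 𝔤 (LieAlgebra.LoopAlgebra.toFinsupp ℂ ℤ 𝔤 f)
        (LieAlgebra.LoopAlgebra.toFinsupp ℂ ℤ 𝔤 g) := by
  have hadd (f g h : LieAlgebra.loopAlgebra ℂ ℤ 𝔤) : ⁅f + g, h⁆ = ⁅f, h⁆ + ⁅g, h⁆ := add_lie f g h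
  have haddr (f g h : LieAlgebra.loopAlgebra ℂ ℤ 𝔤) : ⁅f, g + h⁆ = ⁅f, g⁆ + ⁅f, h⁆ := lie_add f g h
  have hzero (f : LieAlgebra.loopAlgebra ℂ ℤ 𝔤) : ⁅(0 : LieAlgebra.loopAlgebra ℂ ℤ 𝔤), f⁆ = 0 :=
    zero_lie f
  have hzeror (f : LieAlgebra.loopAlgebra ℂ ℤ 𝔤) : ⁅f, (0 : LieAlgebra.loopAlgebra ℂ ℤ 𝔤)⁆ = 0 :=
    lie_zero f
  obtain ⟨f, rfl⟩ := (LieAlgebra.LoopAlgebra.toFinsupp ℂ ℤ 𝔤).symm.surjective f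
  obtain ⟨g, rfl⟩ := (LieAlgebra.LoopAlgebra.toFinsupp ℂ ℤ 𝔤).symm.surjective g
  rw [LinearEquiv.apply_symm_apply, LinearEquiv.apply_symm_apply]
  induction f using Finsupp.induction_linear with
  | zero => rw [map_zero, map_zero, LinearMap.zero_apply, hzero, map_zero]
  | add f f' hf hf' => rw [map_add, hadd, map_add, map_add, LinearMap.add_apply, hf, hf']
  | single m x =>
  induction g using Finsupp.induction_linear with
  | zero => rw [map_zero, map_zero, hzeror, map_zero]
  | add g g' hg hg' => rw [map_add, haddr, map_add, map_add, hg, hg']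
  | single n y =>
  rw [LieAlgebra.LoopAlgebra.toFinsupp_symm_single, LieAlgebra.LoopAlgebra.toFinsupp_symm_single,
    LieAlgebra.ExtendScalars.bracket_tmul, AddMonoidAlgebra.single_mul_single, mul_one,
    LieAlgebra.LoopAlgebra.toFinsupp_single_tmul, loopBracket_single]

lemma loopBracket_skew (f g : ℤ →₀ 𝔤) : loopBracket 𝔤 f g = -loopBracket 𝔤 g f := by
  induction f using Finsupp.induction_linear with
  | zero => simp
  | add f f' hf hf' => simp only [map_add, LinearMap.add_apply, hf, hf']; abel
  | single m x =>
  induction g using Finsupp.induction_linear with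
  | zero => simp
  | add g g' hg hg' => simp only [map_add, LinearMap.add_apply, hg, hg']; abel
  | single n y =>
  rw [loopBracket_single, loopBracket_single, ← Finsupp.single_neg, add_comm n m, lie_skew]

lemma loopBracket_self (f : ℤ →₀ 𝔤) : loopBracket 𝔤 f f = 0 := by
  have h : (2 : ℂ) • loopBracket 𝔤 f f = 0 := by
    rw [two_smul]
    exact eq_neg_iff_add_eq_zero.mp (loopBracket_skew f f)
  exact (smul_eq_zero.mp h).resolve_left two_ne_zero

lemma affineCocycle_skew (f g : ℤ →₀ 𝔤) : affineCocycle 𝔤 f g = -affineCocycle 𝔤 g f := by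
  induction f using Finsupp.induction_linear with
  | zero => simp
  | add f f' hf hf' => simp only [map_add, LinearMap.add_apply, hf, hf']; abel
  | single m x =>
  induction g using Finsupp.induction_linear with
  | zero => simp
  | add g g' hg hg' => simp only [map_add, LinearMap.add_apply, hg, hg']; abel
  | single n y =>
  rw [affineCocycle_single, affineCocycle_single, LieModule.traceForm_comm ℂ 𝔤 𝔤 y x, add_comm n m]
  split_ifs with h
  · obtain rfl : n = -m := by omega
    push_cast
    ring
  · simp

lemma affineCocycle_self (f : ℤ →₀ 𝔤) : affineCocycle 𝔤 f f = 0 :=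
  self_eq_neg.mp (affineCocycle_skew f f)

lemma loopBracket_jacobi (f g h : ℤ →₀ 𝔤) :
    loopBracket 𝔤 f (loopBracket 𝔤 g h) =
      loopBracket 𝔤 (loopBracket 𝔤 f g) h + loopBracket 𝔤 g (loopBracket 𝔤 f h) := by
  induction f using Finsupp.induction_linear with
  | zero => simp
  | add f f' hf hf' => simp only [map_add, LinearMap.add_apply, hf, hf']; abel
  | single m x =>
  induction g using Finsupp.induction_linear with
  | zero => simp
  | add g g' hg hg' => simp only [map_add, LinearMap.add_apply, hg, hg']; abel
  | single n y =>
  induction h using Finsupp.induction_linear with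
  | zero => simp
  | add h h' hh hh' => simp only [map_add, hh, hh']; abel
  | single k z =>
  simp only [loopBracket_single]
  rw [show m + n + k = m + (n + k) by ring, show n + (m + k) = m + (n + k) by ring]
  rw [← Finsupp.single_add, ← leibniz_lie]

lemma affineCocycle_jacobi (f g h : ℤ →₀ 𝔤) :
    affineCocycle 𝔤 f (loopBracket 𝔤 g h) =
      affineCocycle 𝔤 (loopBracket 𝔤 f g) h + affineCocycle 𝔤 g (loopBracket 𝔤 f h) := by
  induction f using Finsupp.induction_linear with
  | zero => simp
  | add f f' hf hf' => simp only [map_add, LinearMap.add_apply, hf, hf']; abel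
  | single m x =>
  induction g using Finsupp.induction_linear with
  | zero => simp
  | add g g' hg hg' => simp only [map_add, LinearMap.add_apply, hg, hg']; abel
  | single n y =>
  induction h using Finsupp.induction_linear with
  | zero => simp
  | add h h' hh hh' => simp only [map_add, hh, hh']; abel
  | single k z =>
  simp only [loopBracket_single, affineCocycle_single]
  rw [show m + n + k = m + (n + k) by ring, show n + (m + k) = m + (n + k) by ring]
  have h1 : killingForm ℂ 𝔤 ⁅x, y⁆ z = killingForm ℂ 𝔤 x ⁅y, z⁆ :=
    LieModule.traceForm_apply_lie_apply ℂ 𝔤 𝔤 x y z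
  have h2 : killingForm ℂ 𝔤 y ⁅x, z⁆ = -killingForm ℂ 𝔤 x ⁅y, z⁆ := by
    rw [← h1, ← lie_skew x y, map_neg, LinearMap.neg_apply, neg_neg]
    exact (LieModule.traceForm_apply_lie_apply ℂ 𝔤 𝔤 y x z).symm
  rw [h1, h2]
  split_ifs with h
  · push_cast
    ring
  · simp

lemma loopAction_lie (u : ℤ →₀ ℂ) (f g : ℤ →₀ 𝔤) :
    loopAction 𝔤 u (loopBracket 𝔤 f g) =
      loopBracket 𝔤 (loopAction 𝔤 u f) g + loopBracket 𝔤 f (loopAction 𝔤 u g) := by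
  induction u using Finsupp.induction_linear with
  | zero => simp
  | add u u' hu hu' => simp only [map_add, LinearMap.add_apply, hu, hu']; abel
  | single m a =>
  induction f using Finsupp.induction_linear with
  | zero => simp
  | add f f' hf hf' => simp only [map_add, LinearMap.add_apply, hf, hf']; abel
  | single n x =>
  induction g using Finsupp.induction_linear with
  | zero => simp
  | add g g' hg hg' => simp only [map_add, hg, hg']; abel
  | single k y =>
  simp only [loopBracket_single, loopAction_single]
  rw [show m + n + k = m + (n + k) by ring, show n + (m + k) = m + (n + k) by ring]
  rw [← Finsupp.single_add, smul_lie, lie_smul, ← add_smul]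
  congr 2
  push_cast
  ring

lemma loopAction_wittBracket (u v : ℤ →₀ ℂ) (f : ℤ →₀ 𝔤) :
    loopAction 𝔤 (wittBracket u v) f =
      loopAction 𝔤 u (loopAction 𝔤 v f) - loopAction 𝔤 v (loopAction 𝔤 u f) := by
  induction u using Finsupp.induction_linear with
  | zero => simp
  | add u u' hu hu' => simp only [map_add, LinearMap.add_apply, hu, hu']; abel
  | single m a =>
  induction v using Finsupp.induction_linear with
  | zero => simp
  | add v v' hv hv' => simp only [map_add, LinearMap.add_apply, hv, hv']; abel
  | single n b =>
  induction f using Finsupp.induction_linear with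
  | zero => simp
  | add f f' hf hf' => simp only [map_add, hf, hf']; abel
  | single k x =>
  simp only [wittBracket_single, loopAction_single]
  rw [show m + n + k = m + (n + k) by ring, show n + (m + k) = m + (n + k) by ring]
  rw [← Finsupp.single_sub, smul_smul, smul_smul, ← sub_smul]
  congr 2
  push_cast
  ring

lemma affineCocycle_loopAction (u : ℤ →₀ ℂ) (f g : ℤ →₀ 𝔤) :
    affineCocycle 𝔤 (loopAction 𝔤 u f) g = -affineCocycle 𝔤 f (loopAction 𝔤 u g) := by
  induction u using Finsupp.induction_linear with
  | zero => simp
  | add u u' hu hu' => simp only [map_add, LinearMap.add_apply, hu, hu']; abel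
  | single m a =>
  induction f using Finsupp.induction_linear with
  | zero => simp
  | add f f' hf hf' => simp only [map_add, LinearMap.add_apply, hf, hf']; abel
  | single n x =>
  induction g using Finsupp.induction_linear with
  | zero => simp
  | add g g' hg hg' => simp only [map_add, hg, hg']; abel
  | single k y =>
  simp only [loopAction_single, affineCocycle_single, map_smul, LinearMap.smul_apply, smul_eq_mul]
  rw [show n + (m + k) = m + n + k by ring]
  split_ifs with h
  · obtain rfl : k = -(m + n) := by omega
    push_cast
    ring
  · simp

end AffineVirasoro

/-- The affine-Virasoro Lie algebra
`𝔏(𝔤) = 𝔤 ⊗ ℂ[t, t⁻¹] ⊕ ℂ K₁ ⊕ ℂ K₂ ⊕ ⨁ m, ℂ d_m` of a complex Lie algebra `𝔤`. -/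
@[ext]
structure AffineVirasoro (𝔤 : Type*) [LieRing 𝔤] [LieAlgebra ℂ 𝔤] where
  /-- The component in the loop algebra `𝔤 ⊗ ℂ[t, t⁻¹]`. -/
  loop : ℤ →₀ 𝔤
  /-- The coefficient of `K₁`. -/
  k₁ : ℂ
  /-- The coefficient of `K₂`. -/
  k₂ : ℂ
  /-- The component in `⨁ m, ℂ d_m`. -/
  vir : ℤ →₀ ℂ

namespace AffineVirasoro

variable {𝔤 : Type*} [LieRing 𝔤] [LieAlgebra ℂ 𝔤]

variable (𝔤) in
/-- The underlying direct sum; the vector space structure is transported along this bijection. -/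
def toProd : AffineVirasoro 𝔤 ≃ (ℤ →₀ 𝔤) × ℂ × ℂ × (ℤ →₀ ℂ) where
  toFun x := (x.loop, x.k₁, x.k₂, x.vir)
  invFun x := ⟨x.1, x.2.1, x.2.2.1, x.2.2.2⟩
  left_inv _ := rfl
  right_inv _ := rfl

instance : AddCommGroup (AffineVirasoro 𝔤) := (toProd 𝔤).addCommGroup

instance : Module ℂ (AffineVirasoro 𝔤) := (toProd 𝔤).module ℂ

@[simp] lemma zero_loop : (0 : AffineVirasoro 𝔤).loop = 0 := rfl
@[simp] lemma zero_k₁ : (0 : AffineVirasoro 𝔤).k₁ = 0 := rfl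
@[simp] lemma zero_k₂ : (0 : AffineVirasoro 𝔤).k₂ = 0 := rfl
@[simp] lemma zero_vir : (0 : AffineVirasoro 𝔤).vir = 0 := rfl
@[simp] lemma add_loop (x y : AffineVirasoro 𝔤) : (x + y).loop = x.loop + y.loop := rfl
@[simp] lemma add_k₁ (x y : AffineVirasoro 𝔤) : (x + y).k₁ = x.k₁ + y.k₁ := rfl
@[simp] lemma add_k₂ (x y : AffineVirasoro 𝔤) : (x + y).k₂ = x.k₂ + y.k₂ := rfl
@[simp] lemma add_vir (x y : AffineVirasoro 𝔤) : (x + y).vir = x.vir + y.vir := rfl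
@[simp] lemma smul_loop (c : ℂ) (x : AffineVirasoro 𝔤) : (c • x).loop = c • x.loop := rfl
@[simp] lemma smul_k₁ (c : ℂ) (x : AffineVirasoro 𝔤) : (c • x).k₁ = c * x.k₁ := rfl
@[simp] lemma smul_k₂ (c : ℂ) (x : AffineVirasoro 𝔤) : (c • x).k₂ = c * x.k₂ := rfl
@[simp] lemma smul_vir (c : ℂ) (x : AffineVirasoro 𝔤) : (c • x).vir = c • x.vir := rfl

/-- The bracket, in components; it is determined by bilinearity, skew-symmetry and the relations
`lie_tensor_tensor`, `lie_K₁`, `lie_K₂`, `lie_d_tensor`, `lie_d_d` proved below. -/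
instance : Bracket (AffineVirasoro 𝔤) (AffineVirasoro 𝔤) where
  bracket x y :=
    { loop := loopBracket 𝔤 x.loop y.loop + loopAction 𝔤 x.vir y.loop - loopAction 𝔤 y.vir x.loop
      k₁ := affineCocycle 𝔤 x.loop y.loop
      k₂ := virasoroCocycle x.vir y.vir
      vir := wittBracket x.vir y.vir }

@[simp] lemma lie_loop (x y : AffineVirasoro 𝔤) : ⁅x, y⁆.loop =
    loopBracket 𝔤 x.loop y.loop + loopAction 𝔤 x.vir y.loop - loopAction 𝔤 y.vir x.loop := rfl
@[simp] lemma lie_k₁ (x y : AffineVirasoro 𝔤) :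
    ⁅x, y⁆.k₁ = affineCocycle 𝔤 x.loop y.loop := rfl
@[simp] lemma lie_k₂ (x y : AffineVirasoro 𝔤) :
    ⁅x, y⁆.k₂ = virasoroCocycle x.vir y.vir := rfl
@[simp] lemma lie_vir (x y : AffineVirasoro 𝔤) :
    ⁅x, y⁆.vir = wittBracket x.vir y.vir := rfl

instance : LieRing (AffineVirasoro 𝔤) where
  add_lie x y z := by
    apply AffineVirasoro.ext
    · simp only [lie_loop, add_loop, add_vir, map_add, LinearMap.add_apply]; abel
    all_goals simp
  lie_add x y z := by
    apply AffineVirasoro.ext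
    · simp only [lie_loop, add_loop, add_vir, map_add, LinearMap.add_apply]; abel
    all_goals simp
  lie_self x := by
    apply AffineVirasoro.ext
    · simp [loopBracket_self]
    · simp [affineCocycle_self]
    · simp [virasoroCocycle_self]
    · simp [wittBracket_self]
  leibniz_lie x y z := by
    apply AffineVirasoro.ext
    · simp only [lie_loop, lie_vir, add_loop, map_add, map_sub, LinearMap.add_apply,
        LinearMap.sub_apply, loopAction_lie, loopAction_wittBracket,
        loopBracket_jacobi x.loop y.loop z.loop,
        loopBracket_skew y.loop (loopAction 𝔤 z.vir x.loop)]
      abel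
    · simp only [lie_k₁, lie_loop, add_k₁, map_add, map_sub, LinearMap.add_apply,
        LinearMap.sub_apply, affineCocycle_jacobi x.loop y.loop z.loop, affineCocycle_loopAction,
        affineCocycle_skew y.loop (loopAction 𝔤 z.vir x.loop)]
      ring
    · simpa using virasoroCocycle_jacobi x.vir y.vir z.vir
    · simpa using wittBracket_jacobi x.vir y.vir z.vir

instance : LieAlgebra ℂ (AffineVirasoro 𝔤) where
  lie_smul c x y := by
    apply AffineVirasoro.ext
    · simp [smul_add, smul_sub]
    all_goals simp

/-- The element `x ⊗ t ^ m`. -/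
def tensor (x : 𝔤) (m : ℤ) : AffineVirasoro 𝔤 := ⟨Finsupp.single m x, 0, 0, 0⟩

variable (𝔤) in
/-- The central element `K₁`. -/
def K₁ : AffineVirasoro 𝔤 := ⟨0, 1, 0, 0⟩

variable (𝔤) in
/-- The central element `K₂`. -/
def K₂ : AffineVirasoro 𝔤 := ⟨0, 0, 1, 0⟩

variable (𝔤) in
/-- The element `d_m`. -/
def d (m : ℤ) : AffineVirasoro 𝔤 := ⟨0, 0, 0, Finsupp.single m 1⟩

lemma lie_tensor_tensor (x y : 𝔤) (m n : ℤ) :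
    ⁅tensor x m, tensor y n⁆ =
      tensor ⁅x, y⁆ (m + n) + (if m + n = 0 then (m : ℂ) * killingForm ℂ 𝔤 x y else 0) • K₁ 𝔤 := by
  split_ifs <;> apply AffineVirasoro.ext <;> simp_all [tensor, K₁, loopBracket_single, affineCocycle_single]

lemma lie_K₁ (x : AffineVirasoro 𝔤) : ⁅x, K₁ 𝔤⁆ = 0 := by
  apply AffineVirasoro.ext <;> simp [K₁]

lemma lie_K₂ (x : AffineVirasoro 𝔤) : ⁅x, K₂ 𝔤⁆ = 0 := by
  apply AffineVirasoro.ext <;> simp [K₂]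

lemma lie_d_tensor (m n : ℤ) (x : 𝔤) : ⁅d 𝔤 m, tensor x n⁆ = (n : ℂ) • tensor x (m + n) := by
  apply AffineVirasoro.ext <;> simp [d, tensor, loopAction_single]

lemma lie_d_d (m n : ℤ) :
    ⁅d 𝔤 m, d 𝔤 n⁆ = ((n : ℂ) - (m : ℂ)) • d 𝔤 (m + n) +
      (if m + n = 0 then ((m : ℂ) ^ 3 - (m : ℂ)) / 12 else 0) • K₂ 𝔤 := by
  split_ifs <;> apply AffineVirasoro.ext <;> simp_all [d, K₂, wittBracket_single, virasoroCocycle_single]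

end AffineVirasoro

section Biderivation

variable {L V : Type*} [LieRing L] [LieAlgebra ℂ L] [AddCommGroup V] [Module ℂ V]

/-- A bilinear map `F : L × L → V` into a module over the Lie algebra `L` is a biderivation if it is
a derivation in each argument. A biderivation of `L` is the case of the adjoint module `V = L`. -/
structure IsBiderivation [LieRingModule L V] [LieModule ℂ L V] (F : L →ₗ[ℂ] L →ₗ[ℂ] V) : Prop where
  lie_left : ∀ x y z : L, F ⁅x, y⁆ z = ⁅x, F y z⁆ - ⁅y, F x z⁆
  lie_right : ∀ x y z : L, F x ⁅y, z⁆ = ⁅y, F x z⁆ - ⁅z, F x y⁆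

/-- A bilinear map `F : L × L → V` is symmetric if `F (x, y) = F (y, x)`. -/
def IsSymmetricBilinear (F : L →ₗ[ℂ] L →ₗ[ℂ] V) : Prop :=
  ∀ x y : L, F x y = F y x

end Biderivation

end

/-! Grade the algebra by `ad d_0` and work modulo the centre, tracking only `loop` and `vir`
components. For `x` of degree `m`, expanding `F([d_0, x], y)` shows that `k - m` times the degree
`k` part of `F(x, y)` is the degree `k` part of `[x, F(d_0, y)]`. Hence `F(d_0, ·)` controls `F(x,
y)` outside degree `m`.

Taking `k = m` forces the degree `0` part of `F(d_0, y)` to vanish. Symmetry allows the same value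
to be computed from either argument; comparing the two results makes `F(d_0, ·)` central
(`apply_d_zero_mem_central`). Then, modulo the centre, `F(x, y)` lives in the degree of `x` and also
in that of `y`, so it is central when these differ. Equal degrees reduce to unequal ones by writing
`y`, up to `K₂`, as a bracket. Finally a central-valued biderivation kills all brackets, and the
algebra is perfect (`eq_zero_of_forall_map_lie_eq_zero`). -/

namespace AffineVirasoro

/-! ### Spanning set, components of brackets, grading by `d_0` -/

section Structure

variable {𝔤 : Type*} [LieRing 𝔤] [LieAlgebra ℂ 𝔤]

/-- The affine-Virasoro algebra is spanned by the elements `x ⊗ t ^ n`, `K₁`, `K₂` and `d_n`. -/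
theorem induction_on {P : AffineVirasoro 𝔤 → Prop} (x : AffineVirasoro 𝔤)
    (add : ∀ x y, P x → P y → P (x + y)) (smul : ∀ (c : ℂ) x, P x → P (c • x))
    (tensor : ∀ a n, P (tensor a n)) (d : ∀ n, P (d 𝔤 n)) (K₁ : P (K₁ 𝔤)) (K₂ : P (K₂ 𝔤)) :
    P x := by
  have zero : P 0 := by simpa using smul 0 _ K₁
  have hloop (u : ℤ →₀ 𝔤) : P ⟨u, 0, 0, 0⟩ := by
    induction u using Finsupp.induction_linear with
    | zero => exact zero
    | add u v hu hv =>
      convert add _ _ hu hv using 1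
      apply AffineVirasoro.ext <;> simp
    | single n a => exact tensor a n
  have hvir (u : ℤ →₀ ℂ) : P ⟨0, 0, 0, u⟩ := by
    induction u using Finsupp.induction_linear with
    | zero => exact zero
    | add u v hu hv =>
      convert add _ _ hu hv using 1
      apply AffineVirasoro.ext <;> simp
    | single n a =>
      convert smul a _ (d n) using 1
      apply AffineVirasoro.ext <;> simp [AffineVirasoro.d]
  convert add _ _ (add _ _ (hloop x.loop) (hvir x.vir)) (add _ _ (smul x.k₁ _ K₁) (smul x.k₂ _ K₂))
    using 1
  apply AffineVirasoro.ext <;> simp [AffineVirasoro.K₁, AffineVirasoro.K₂]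

lemma lie_d_loop_apply (m k : ℤ) (v : AffineVirasoro 𝔤) :
    ⁅d 𝔤 m, v⁆.loop k = ((k - m : ℤ) : ℂ) • v.loop (k - m) := by
  have key (f : ℤ →₀ 𝔤) : loopAction 𝔤 (Finsupp.single m 1) f k =
      ((k - m : ℤ) : ℂ) • f (k - m) := by
    induction f using Finsupp.induction_linear with
    | zero => simp
    | add f g hf hg => simp only [map_add, Finsupp.add_apply, hf, hg, smul_add]
    | single n x =>
      rw [loopAction_single]
      by_cases h : n = k - m
      · subst h
        simp
      · rw [Finsupp.single_eq_of_ne (by omega), Finsupp.single_eq_of_ne (by omega), smul_zero]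
  simp [d, key]

lemma lie_d_vir_apply (m k : ℤ) (v : AffineVirasoro 𝔤) :
    ⁅d 𝔤 m, v⁆.vir k = ((k - 2 * m : ℤ) : ℂ) * v.vir (k - m) := by
  have key (f : ℤ →₀ ℂ) : wittBracket (Finsupp.single m 1) f k =
      ((k - 2 * m : ℤ) : ℂ) * f (k - m) := by
    induction f using Finsupp.induction_linear with
    | zero => simp
    | add f g hf hg => simp only [map_add, Finsupp.add_apply, hf, hg, mul_add]
    | single n x =>
      rw [wittBracket_single]
      by_cases h : n = k - m
      · subst h
        simp
        ring_nf
        simp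
      · rw [Finsupp.single_eq_of_ne (by omega), Finsupp.single_eq_of_ne (by omega), mul_zero]
  simp [d, key]

lemma lie_tensor_loop_apply (x : 𝔤) (m k : ℤ) (v : AffineVirasoro 𝔤) :
    ⁅tensor x m, v⁆.loop k = ⁅x, v.loop (k - m)⁆ - ((m : ℂ) * v.vir (k - m)) • x := by
  have key₁ (f : ℤ →₀ 𝔤) : loopBracket 𝔤 (Finsupp.single m x) f k = ⁅x, f (k - m)⁆ := by
    induction f using Finsupp.induction_linear with
    | zero => simp
    | add f g hf hg => simp only [map_add, Finsupp.add_apply, hf, hg, lie_add]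
    | single n y =>
      rw [loopBracket_single]
      by_cases h : n = k - m
      · subst h
        simp
      · rw [Finsupp.single_eq_of_ne (by omega), Finsupp.single_eq_of_ne (by omega), lie_zero]
  have key₂ (f : ℤ →₀ ℂ) : loopAction 𝔤 f (Finsupp.single m x) k =
      ((m : ℂ) * f (k - m)) • x := by
    induction f using Finsupp.induction_linear with
    | zero => simp
    | add f g hf hg =>
      simp only [map_add, LinearMap.add_apply, Finsupp.add_apply, hf, hg, mul_add, add_smul]
    | single n a =>
      rw [loopAction_single]
      by_cases h : n = k - m
      · subst h
        simp
      · rw [Finsupp.single_eq_of_ne (by omega), Finsupp.single_eq_of_ne (by omega), mul_zero,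
          zero_smul]
  simp [tensor, key₁, key₂]

lemma lie_tensor_vir (x : 𝔤) (m : ℤ) (v : AffineVirasoro 𝔤) : ⁅tensor x m, v⁆.vir = 0 := by
  simp [tensor]

variable (𝔤) in
/-- The span of `K₁` and `K₂`. -/
def central : Submodule ℂ (AffineVirasoro 𝔤) where
  carrier := {v | v.loop = 0 ∧ v.vir = 0}
  add_mem' hu hv := by simp_all
  zero_mem' := by simp
  smul_mem' c v hv := by simp_all

lemma lie_eq_zero_of_mem_central {v : AffineVirasoro 𝔤} (hv : v ∈ central 𝔤)
    (x : AffineVirasoro 𝔤) : ⁅x, v⁆ = 0 := by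
  obtain ⟨h₁, h₂⟩ := hv
  apply AffineVirasoro.ext <;> simp [h₁, h₂]

lemma mem_central_of_components {v : AffineVirasoro 𝔤} (n : ℤ)
    (hloop : ∀ k, k ≠ n → v.loop k = 0) (hvir : ∀ k, k ≠ n → v.vir k = 0)
    (hloop' : v.loop n = 0) (hvir' : v.vir n = 0) : v ∈ central 𝔤 := by
  refine ⟨Finsupp.ext fun k => ?_, Finsupp.ext fun k => ?_⟩ <;> by_cases h : k = n
  · exact h ▸ hloop'
  · exact hloop k h
  · exact h ▸ hvir'
  · exact hvir k h

/-- `v` is homogeneous of degree `n` for the grading given by `d_0`. -/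
def IsHomogeneous (n : ℤ) (v : AffineVirasoro 𝔤) : Prop := ⁅d 𝔤 0, v⁆ = (n : ℂ) • v

lemma isHomogeneous_tensor (x : 𝔤) (n : ℤ) : IsHomogeneous n (tensor x n) := by
  rw [IsHomogeneous, lie_d_tensor, zero_add]

lemma isHomogeneous_d (n : ℤ) : IsHomogeneous n (d 𝔤 n) := by
  rw [IsHomogeneous, lie_d_d]
  simp

lemma isHomogeneous_K₁ : IsHomogeneous 0 (K₁ 𝔤) := by
  rw [IsHomogeneous, lie_K₁]
  simp

lemma isHomogeneous_K₂ : IsHomogeneous 0 (K₂ 𝔤) := by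
  rw [IsHomogeneous, lie_K₂]
  simp

end Structure

/-! ### The centre -/

lemma eq_zero_of_forall_lie_eq_zero {𝔤 : Type*} [LieRing 𝔤] [LieAlgebra ℂ 𝔤]
    [LieAlgebra.IsSimple ℂ 𝔤] {a : 𝔤} (h : ∀ x : 𝔤, ⁅x, a⁆ = 0) : a = 0 := by
  have ha : a ∈ LieAlgebra.center ℂ 𝔤 := h
  rwa [LieAlgebra.center_eq_bot, LieSubmodule.mem_bot] at ha

lemma mem_central_of_forall_lie_eq_zero {𝔤 : Type*} [LieRing 𝔤] [LieAlgebra ℂ 𝔤]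
    [LieAlgebra.IsSimple ℂ 𝔤] {v : AffineVirasoro 𝔤}
    (h : ∀ u : AffineVirasoro 𝔤, ⁅u, v⁆ = 0) :
    v ∈ central 𝔤 := by
  refine mem_central_of_components 0 (fun k hk => ?_) (fun k hk => ?_) ?_ ?_
  · have := lie_d_loop_apply 0 k v
    rw [h] at this
    simpa [hk] using this.symm
  · have := lie_d_vir_apply 0 k v
    rw [h] at this
    simpa [hk] using this
  · refine eq_zero_of_forall_lie_eq_zero fun x => ?_
    have := lie_tensor_loop_apply x 0 0 v
    rw [h] at this
    simpa using this.symm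
  -- `d_0` commutes with itself, so its coefficient has to be detected by `d_1`.
  · have := lie_d_vir_apply 1 1 v
    rw [h] at this
    simpa using this

/-! ### Perfectness -/

section Simple

variable {𝔤 : Type*} [LieRing 𝔤] [LieAlgebra ℂ 𝔤] [FiniteDimensional ℂ 𝔤]
  [LieAlgebra.IsSimple ℂ 𝔤]

variable (𝔤) in
lemma exists_killingForm_ne_zero : ∃ x y : 𝔤, killingForm ℂ 𝔤 x y ≠ 0 := by
  by_contra! h
  have := LieAlgebra.IsSimple.nontrivial ℂ 𝔤
  obtain ⟨x, hx⟩ := exists_ne (0 : 𝔤)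
  have hker : x ∈ LinearMap.ker (killingForm ℂ 𝔤) := LinearMap.ext (h x)
  rw [LieAlgebra.IsKilling.ker_killingForm_eq_bot] at hker
  exact hx hker

/-- The affine-Virasoro algebra is perfect: a linear map vanishing on all brackets vanishes. -/
theorem eq_zero_of_forall_map_lie_eq_zero {V : Type*} [AddCommGroup V] [Module ℂ V]
    (T : AffineVirasoro 𝔤 →ₗ[ℂ] V) (h : ∀ x y : AffineVirasoro 𝔤, T ⁅x, y⁆ = 0)
    (x : AffineVirasoro 𝔤) : T x = 0 := by
  have htensor (a : 𝔤) (n : ℤ) : T (tensor a n) = 0 := by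
    by_cases hn : n = 0
    · have := h (d 𝔤 1) (tensor a (n - 1))
      rw [lie_d_tensor] at this
      simpa [hn] using this
    · have := h (d 𝔤 0) (tensor a n)
      rw [lie_d_tensor] at this
      simpa [hn] using this
  have hd0 : T (d 𝔤 0) = 0 := by
    -- The cocycle `m ^ 3 - m` vanishes at `m = 1`, so this bracket is a pure multiple of `d_0`.
    have := h (d 𝔤 1) (d 𝔤 (-1))
    rw [lie_d_d, map_add, map_smul, map_smul] at this
    norm_num at this
    simpa using this
  induction x using induction_on with
  | add x y hx hy => rw [map_add, hx, hy, add_zero]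
  | smul c x hx => rw [map_smul, hx, smul_zero]
  | tensor a n => exact htensor a n
  | d n =>
    by_cases hn : n = 0
    · rw [hn, hd0]
    · have := h (d 𝔤 0) (d 𝔤 n)
      rw [lie_d_d] at this
      simpa [hn] using this
  | K₁ =>
    obtain ⟨a, b, hab⟩ := exists_killingForm_ne_zero 𝔤
    have := h (tensor a 1) (tensor b (-1))
    rw [lie_tensor_tensor, map_add, htensor] at this
    simpa [hab] using this
  | K₂ =>
    -- At `m = 2` the cocycle is nonzero: the bracket is `-4 d_0 + K₂ / 2`.
    have := h (d 𝔤 2) (d 𝔤 (-2))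
    rw [lie_d_d, map_add, map_smul, map_smul] at this
    norm_num [hd0] at this
    exact this

end Simple

/-! ### Values of `F(d_0, ·)` in each degree -/

section Biderivation

variable {𝔤 : Type*} [LieRing 𝔤] [LieAlgebra ℂ 𝔤]
  {F : AffineVirasoro 𝔤 →ₗ[ℂ] AffineVirasoro 𝔤 →ₗ[ℂ] AffineVirasoro 𝔤}

lemma smul_apply_of_isHomogeneous (hF : IsBiderivation F) {m : ℤ} {x : AffineVirasoro 𝔤}
    (hx : IsHomogeneous m x) (y : AffineVirasoro 𝔤) :
    (m : ℂ) • F x y = ⁅d 𝔤 0, F x y⁆ - ⁅x, F (d 𝔤 0) y⁆ := by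
  rw [← hF.lie_left, hx, map_smul, LinearMap.smul_apply]

/-- `ad d_0` multiplies the degree `k` part by `k`. For `k ≠ m` this determines that part from
`F(d_0, y)`; for `k = m` it is a constraint on `F(d_0, y)` itself. -/
lemma smul_loop_apply (hF : IsBiderivation F) {m : ℤ} {x : AffineVirasoro 𝔤}
    (hx : IsHomogeneous m x) (y : AffineVirasoro 𝔤) (k : ℤ) :
    ((k - m : ℤ) : ℂ) • (F x y).loop k = ⁅x, F (d 𝔤 0) y⁆.loop k := by
  have h := congrArg (fun v => v.loop k) (sub_eq_iff_eq_add.mp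
    (smul_apply_of_isHomogeneous hF hx y).symm)
  simp only [smul_loop, add_loop, Finsupp.add_apply, Finsupp.smul_apply, lie_d_loop_apply,
    sub_zero] at h
  rw [Int.cast_sub, sub_smul, h, add_sub_cancel_left]

lemma mul_vir_apply (hF : IsBiderivation F) {m : ℤ} {x : AffineVirasoro 𝔤}
    (hx : IsHomogeneous m x) (y : AffineVirasoro 𝔤) (k : ℤ) :
    ((k - m : ℤ) : ℂ) * (F x y).vir k = ⁅x, F (d 𝔤 0) y⁆.vir k := by
  have h := congrArg (fun v => v.vir k) (sub_eq_iff_eq_add.mp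
    (smul_apply_of_isHomogeneous hF hx y).symm)
  simp only [smul_vir, add_vir, Finsupp.add_apply, Finsupp.smul_apply, lie_d_vir_apply,
    sub_zero, mul_zero, smul_eq_mul] at h
  rw [Int.cast_sub, sub_mul, h, add_sub_cancel_left]

lemma vir_zero_apply_d_zero (hF : IsBiderivation F) (y : AffineVirasoro 𝔤) :
    (F (d 𝔤 0) y).vir 0 = 0 := by
  have h := mul_vir_apply hF (isHomogeneous_d 1) y 1
  rw [lie_d_vir_apply] at h
  simpa using h.symm

/-- The degree `m + n` part of `F(d_m, d_n) = F(d_n, d_m)` is computed from each argument;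
cancelling `n` and `m` leaves the two sides. -/
lemma loop_apply_d_zero_d (hF : IsBiderivation F) (hsymm : IsSymmetricBilinear F)
    {m n : ℤ} (hm : m ≠ 0) (hn : n ≠ 0) :
    (F (d 𝔤 0) (d 𝔤 m)).loop m = (F (d 𝔤 0) (d 𝔤 n)).loop n := by
  have h₁ := smul_loop_apply hF (isHomogeneous_d m) (d 𝔤 n) (m + n)
  have h₂ := smul_loop_apply hF (isHomogeneous_d n) (d 𝔤 m) (m + n)
  rw [lie_d_loop_apply] at h₁ h₂
  rw [hsymm] at h₂
  simp only [add_sub_cancel_left, add_sub_cancel_right] at h₁ h₂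
  have hm' : (m : ℂ) ≠ 0 := by exact_mod_cast hm
  have hn' : (n : ℂ) ≠ 0 := by exact_mod_cast hn
  rw [← smul_right_injective _ hn' h₁, ← smul_right_injective _ hm' h₂]

lemma vir_apply_d_zero_tensor (hF : IsBiderivation F) (hsymm : IsSymmetricBilinear F)
    (x : 𝔤) {n : ℤ} (hn : n ≠ 0) : (F (d 𝔤 0) (tensor x n)).vir n = 0 := by
  -- In degree `0` the second computation gives zero, as brackets with the loop algebra have no
  -- `vir` part, while the first gives twice the wanted coefficient.
  have h₁ := mul_vir_apply hF (isHomogeneous_d (-n)) (tensor x n) 0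
  have h₂ := mul_vir_apply hF (isHomogeneous_tensor x n) (d 𝔤 (-n)) 0
  rw [lie_d_vir_apply] at h₁
  rw [lie_tensor_vir, hsymm] at h₂
  simp_all

lemma vir_apply_d_zero_d (hF : IsBiderivation F) (hsymm : IsSymmetricBilinear F)
    {n : ℤ} (hn : n ≠ 0) : (F (d 𝔤 0) (d 𝔤 n)).vir n = 0 := by
  have key (i j : ℤ) (hij : i ≠ j) : (i : ℂ) * (F (d 𝔤 0) (d 𝔤 j)).vir j =
      -((j : ℂ) * (F (d 𝔤 0) (d 𝔤 i)).vir i) := by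
    have h₁ := mul_vir_apply hF (isHomogeneous_d i) (d 𝔤 j) (i + j)
    have h₂ := mul_vir_apply hF (isHomogeneous_d j) (d 𝔤 i) (i + j)
    rw [lie_d_vir_apply] at h₁ h₂
    rw [hsymm] at h₂
    simp only [add_sub_cancel_left, add_sub_cancel_right] at h₁ h₂
    have hij' : (i : ℂ) - j ≠ 0 := sub_ne_zero.mpr (by exact_mod_cast hij)
    push_cast at h₁ h₂
    apply mul_left_cancel₀ hij'
    linear_combination (i : ℂ) * h₁ - (j : ℂ) * h₂
  have hn' : (n : ℂ) ≠ 0 := by exact_mod_cast hn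
  -- With `f(j)` the coefficient of `d_j` in `F(d_0, d_j)`, the relation `i f(j) = -j f(i)` makes
  -- `f(j) / j` change sign between any two distinct nonzero indices; three indices `n, 2n, 3n` are
  -- contradictory unless `f(n) = 0`.
  have h₁ := key (2 * n) n (by omega)
  have h₂ := key (3 * n) n (by omega)
  have h₃ := key (3 * n) (2 * n) (by omega)
  push_cast at h₁ h₂ h₃
  have h : (12 * (n : ℂ)) * (F (d 𝔤 0) (d 𝔤 n)).vir n = 0 := by
    linear_combination 3 * h₁ + 2 * h₂ - h₃
  exact (mul_eq_zero.mp h).resolve_left (by simpa using hn')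

/-- Two computations of `F(d_m, x ⊗ t ^ n)` in degree `m + n`. The right side is independent of `m`,
so comparing `m = 1` and `m = 2` makes both sides vanish. -/
lemma smul_loop_apply_d_zero_tensor (hF : IsBiderivation F) (hsymm : IsSymmetricBilinear F)
    (x : 𝔤) {m n : ℤ} (hm : m ≠ 0) (hn : n ≠ 0) :
    (m : ℂ) • (F (d 𝔤 0) (tensor x n)).loop n = ⁅x, (F (d 𝔤 0) (d 𝔤 1)).loop 1⁆ := by
  have h₁ := smul_loop_apply hF (isHomogeneous_d m) (tensor x n) (m + n)
  have h₂ := smul_loop_apply hF (isHomogeneous_tensor x n) (d 𝔤 m) (m + n)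
  rw [lie_d_loop_apply] at h₁
  rw [lie_tensor_loop_apply, hsymm] at h₂
  simp only [add_sub_cancel_left, add_sub_cancel_right] at h₁ h₂
  rw [vir_apply_d_zero_d hF hsymm hm, mul_zero, zero_smul, sub_zero,
    loop_apply_d_zero_d hF hsymm hm one_ne_zero] at h₂
  have hn' : (n : ℂ) ≠ 0 := by exact_mod_cast hn
  rw [← h₂, smul_right_injective _ hn' h₁]

lemma loop_apply_d_zero_tensor (hF : IsBiderivation F) (hsymm : IsSymmetricBilinear F)
    (x : 𝔤) {n : ℤ} (hn : n ≠ 0) : (F (d 𝔤 0) (tensor x n)).loop n = 0 := by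
  have h₁ := smul_loop_apply_d_zero_tensor hF hsymm x one_ne_zero hn
  have h₂ := smul_loop_apply_d_zero_tensor hF hsymm x two_ne_zero hn
  rw [← h₁, Int.cast_one, Int.cast_ofNat, one_smul, two_smul] at h₂
  simpa using h₂

variable [LieAlgebra.IsSimple ℂ 𝔤]

lemma loop_zero_apply_d_zero (hF : IsBiderivation F) (y : AffineVirasoro 𝔤) :
    (F (d 𝔤 0) y).loop 0 = 0 := by
  refine eq_zero_of_forall_lie_eq_zero fun x => ?_
  -- Here `k = m = 0`: the left side vanishes, and so does the `vir` term of the bracket.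
  have h := smul_loop_apply hF (isHomogeneous_tensor x 0) y 0
  rw [lie_tensor_loop_apply] at h
  simpa using h.symm

lemma apply_d_zero_d_zero_mem_central (hF : IsBiderivation F) (hsymm : IsSymmetricBilinear F) :
    F (d 𝔤 0) (d 𝔤 0) ∈ central 𝔤 := by
  refine mem_central_of_components 0 (fun k hk => ?_) (fun k hk => ?_)
    (loop_zero_apply_d_zero hF _) (vir_zero_apply_d_zero hF _)
  -- Bracketing with `d_{-k}` moves degree `k` to degree `0`, where `F(d_0, d_{-k})` is known to
  -- vanish.
  · have h := smul_loop_apply hF (isHomogeneous_d (-k)) (d 𝔤 0) 0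
    rw [hsymm, loop_zero_apply_d_zero hF, lie_d_loop_apply] at h
    simpa [hk] using h.symm
  · have h := mul_vir_apply hF (isHomogeneous_d (-k)) (d 𝔤 0) 0
    rw [hsymm, vir_zero_apply_d_zero hF, lie_d_vir_apply] at h
    simpa [hk] using h

lemma loop_apply_d_zero_of_ne (hF : IsBiderivation F) (hsymm : IsSymmetricBilinear F)
    {n : ℤ} {y : AffineVirasoro 𝔤} (hy : IsHomogeneous n y) {k : ℤ} (hk : k ≠ n) :
    (F (d 𝔤 0) y).loop k = 0 := by
  have h := smul_loop_apply hF hy (d 𝔤 0) k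
  rw [lie_eq_zero_of_mem_central (apply_d_zero_d_zero_mem_central hF hsymm), hsymm] at h
  exact (smul_eq_zero.mp h).resolve_left (by exact_mod_cast sub_ne_zero.mpr hk)

lemma vir_apply_d_zero_of_ne (hF : IsBiderivation F) (hsymm : IsSymmetricBilinear F)
    {n : ℤ} {y : AffineVirasoro 𝔤} (hy : IsHomogeneous n y) {k : ℤ} (hk : k ≠ n) :
    (F (d 𝔤 0) y).vir k = 0 := by
  have h := mul_vir_apply hF hy (d 𝔤 0) k
  rw [lie_eq_zero_of_mem_central (apply_d_zero_d_zero_mem_central hF hsymm), hsymm] at h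
  exact (mul_eq_zero.mp h).resolve_left (by exact_mod_cast sub_ne_zero.mpr hk)

lemma loop_apply_d_zero_d_eq_zero (hF : IsBiderivation F) (hsymm : IsSymmetricBilinear F)
    {n : ℤ} (hn : n ≠ 0) : (F (d 𝔤 0) (d 𝔤 n)).loop n = 0 := by
  rw [loop_apply_d_zero_d hF hsymm hn one_ne_zero]
  refine eq_zero_of_forall_lie_eq_zero fun x => ?_
  -- The common value for all `d_n` commutes with every `x`, hence is zero.
  rw [← smul_loop_apply_d_zero_tensor hF hsymm x one_ne_zero one_ne_zero,
    loop_apply_d_zero_tensor hF hsymm x one_ne_zero, smul_zero]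

lemma apply_d_zero_mem_central (hF : IsBiderivation F) (hsymm : IsSymmetricBilinear F)
    (y : AffineVirasoro 𝔤) : F (d 𝔤 0) y ∈ central 𝔤 := by
  have key {n : ℤ} {y : AffineVirasoro 𝔤} (hy : IsHomogeneous n y)
      (h : n ≠ 0 → (F (d 𝔤 0) y).loop n = 0 ∧ (F (d 𝔤 0) y).vir n = 0) :
      F (d 𝔤 0) y ∈ central 𝔤 := by
    refine mem_central_of_components n (fun k => loop_apply_d_zero_of_ne hF hsymm hy)
      (fun k => vir_apply_d_zero_of_ne hF hsymm hy) ?_ ?_ <;> by_cases hn : n = 0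
    · exact hn ▸ loop_zero_apply_d_zero hF y
    · exact (h hn).1
    · exact hn ▸ vir_zero_apply_d_zero hF y
    · exact (h hn).2
  induction y using induction_on with
  | add x y hx hy => exact map_add (F (d 𝔤 0)) x y ▸ add_mem hx hy
  | smul c x hx => exact map_smul (F (d 𝔤 0)) c x ▸ Submodule.smul_mem _ c hx
  | tensor a n =>
    exact key (isHomogeneous_tensor a n) fun hn =>
      ⟨loop_apply_d_zero_tensor hF hsymm a hn, vir_apply_d_zero_tensor hF hsymm a hn⟩
  | d n =>
    exact key (isHomogeneous_d n) fun hn =>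
      ⟨loop_apply_d_zero_d_eq_zero hF hsymm hn, vir_apply_d_zero_d hF hsymm hn⟩
  | K₁ => exact key isHomogeneous_K₁ fun h => absurd rfl h
  | K₂ => exact key isHomogeneous_K₂ fun h => absurd rfl h

/-! ### `F` takes central values -/

lemma apply_mem_central_of_ne (hF : IsBiderivation F) (hsymm : IsSymmetricBilinear F)
    {m n : ℤ} {x y : AffineVirasoro 𝔤} (hx : IsHomogeneous m x) (hy : IsHomogeneous n y)
    (hmn : m ≠ n) : F x y ∈ central 𝔤 := by
  have hloop {m : ℤ} {x : AffineVirasoro 𝔤} (hx : IsHomogeneous m x) (y : AffineVirasoro 𝔤)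
      (k : ℤ) (hk : k ≠ m) : (F x y).loop k = 0 := by
    have h := smul_loop_apply hF hx y k
    rw [lie_eq_zero_of_mem_central (apply_d_zero_mem_central hF hsymm y)] at h
    exact (smul_eq_zero.mp h).resolve_left (by exact_mod_cast sub_ne_zero.mpr hk)
  have hvir {m : ℤ} {x : AffineVirasoro 𝔤} (hx : IsHomogeneous m x) (y : AffineVirasoro 𝔤)
      (k : ℤ) (hk : k ≠ m) : (F x y).vir k = 0 := by
    have h := mul_vir_apply hF hx y k
    rw [lie_eq_zero_of_mem_central (apply_d_zero_mem_central hF hsymm y)] at h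
    exact (mul_eq_zero.mp h).resolve_left (by exact_mod_cast sub_ne_zero.mpr hk)
  exact mem_central_of_components m (hloop hx y) (hvir hx y)
    (hsymm x y ▸ hloop hy x m hmn) (hsymm x y ▸ hvir hy x m hmn)

lemma apply_mem_central_of_forall_lie_eq_zero (hF : IsBiderivation F) (x : AffineVirasoro 𝔤)
    {c : AffineVirasoro 𝔤} (hc : ∀ u : AffineVirasoro 𝔤, ⁅u, c⁆ = 0) : F x c ∈ central 𝔤 := by
  refine mem_central_of_forall_lie_eq_zero fun u => ?_
  have h := hF.lie_right x u c
  rw [hc, map_zero, ← lie_skew c, hc, neg_zero, sub_zero] at h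
  exact h.symm

lemma apply_mem_central_of_isHomogeneous (hF : IsBiderivation F) (hsymm : IsSymmetricBilinear F)
    {m : ℤ} {x : AffineVirasoro 𝔤} (hx : IsHomogeneous m x) (y : AffineVirasoro 𝔤) :
    F x y ∈ central 𝔤 := by
  have hlie {i j : ℤ} {u v : AffineVirasoro 𝔤} (hu : IsHomogeneous i u) (hv : IsHomogeneous j v)
      (hi : m ≠ i) (hj : m ≠ j) : F x ⁅u, v⁆ = 0 := by
    rw [hF.lie_right, lie_eq_zero_of_mem_central (apply_mem_central_of_ne hF hsymm hx hv hj),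
      lie_eq_zero_of_mem_central (apply_mem_central_of_ne hF hsymm hx hu hi), sub_zero]
  have hK₂ : F x (K₂ 𝔤) ∈ central 𝔤 := apply_mem_central_of_forall_lie_eq_zero hF x lie_K₂
  -- Degree `m` is reached by bracketing `d_j` with degree `m - j`. The first two conditions keep
  -- both degrees away from `m`; `m ≠ j` and `m ≠ 2 * j` also make the coefficients `m - j` and `m -
  -- 2 * j` nonzero.
  obtain ⟨j, hj₀, hj₁, hj₂⟩ : ∃ j : ℤ, j ≠ 0 ∧ m ≠ j ∧ m ≠ 2 * j :=
    ⟨|m| + 1, by positivity, by have := le_abs_self m; omega,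
      by have := le_abs_self m; have := abs_nonneg m; omega⟩
  induction y using induction_on with
  | add y z hy hz => exact map_add (F x) y z ▸ add_mem hy hz
  | smul c y hy => exact map_smul (F x) c y ▸ Submodule.smul_mem _ c hy
  | tensor a n =>
    by_cases hn : m = n
    · subst hn
      have h := hlie (isHomogeneous_d j) (isHomogeneous_tensor a (m - j)) hj₁ (by omega)
      rw [lie_d_tensor, add_sub_cancel, map_smul] at h
      rw [(smul_eq_zero.mp h).resolve_left (by exact_mod_cast sub_ne_zero.mpr hj₁)]
      exact zero_mem _
    · exact apply_mem_central_of_ne hF hsymm hx (isHomogeneous_tensor a n) hn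
  | d n =>
    by_cases hn : m = n
    · subst hn
      have h := hlie (isHomogeneous_d j) (isHomogeneous_d (m - j)) hj₁ (by omega)
      rw [lie_d_d, add_sub_cancel, map_add, map_smul, map_smul] at h
      have hne : ((m - j : ℤ) : ℂ) - j ≠ 0 := by
        rw [← Int.cast_sub, Int.cast_ne_zero]
        omega
      rw [← Submodule.smul_mem_iff _ hne, eq_neg_of_add_eq_zero_left h]
      exact neg_mem (Submodule.smul_mem _ _ hK₂)
    · exact apply_mem_central_of_ne hF hsymm hx (isHomogeneous_d n) hn
  | K₁ => exact apply_mem_central_of_forall_lie_eq_zero hF x lie_K₁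
  | K₂ => exact hK₂

lemma apply_mem_central (hF : IsBiderivation F) (hsymm : IsSymmetricBilinear F)
    (x y : AffineVirasoro 𝔤) : F x y ∈ central 𝔤 := by
  induction x using induction_on with
  | add x z hx hz => exact LinearMap.map_add₂ F x z y ▸ add_mem hx hz
  | smul c x hx => exact LinearMap.map_smul₂ F c x y ▸ Submodule.smul_mem _ c hx
  | tensor a n => exact apply_mem_central_of_isHomogeneous hF hsymm (isHomogeneous_tensor a n) y
  | d n => exact apply_mem_central_of_isHomogeneous hF hsymm (isHomogeneous_d n) y
  | K₁ => exact apply_mem_central_of_isHomogeneous hF hsymm isHomogeneous_K₁ y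
  | K₂ => exact apply_mem_central_of_isHomogeneous hF hsymm isHomogeneous_K₂ y

end Biderivation

end AffineVirasoro

theorem theorem3p8 (𝔤 : Type*) [LieRing 𝔤] [LieAlgebra ℂ 𝔤] [FiniteDimensional ℂ 𝔤]
    [LieAlgebra.IsSimple ℂ 𝔤]
    (F : AffineVirasoro 𝔤 →ₗ[ℂ] AffineVirasoro 𝔤 →ₗ[ℂ] AffineVirasoro 𝔤)
    (hF : IsBiderivation F) (hsymm : IsSymmetricBilinear F) :
    ∀ x y : AffineVirasoro 𝔤, F x y = 0 := by
  intro x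
  refine AffineVirasoro.eq_zero_of_forall_map_lie_eq_zero (F x) fun y z => ?_
  have hc := AffineVirasoro.apply_mem_central hF hsymm
  rw [hF.lie_right, AffineVirasoro.lie_eq_zero_of_mem_central (hc x z),
    AffineVirasoro.lie_eq_zero_of_mem_central (hc x y), sub_zero]
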